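/- All Banach spaces are complex. For a Banach space $E$, $E^*$ denotes its dual, $\mathcal B(E)$ the Banach algebra of bounded linear operators on $E$, and $T^*$ the Banach space adjoint of $T\in\mathcal B(E)$. Let $\omega_1$ be the first uncountable ordinal and give $[0,\omega_1]$ the order topology; a *club* subset of $[0,\omega_1)$ is one that is closed and unbounded in $[0,\omega_1)$. Let $X$ be a non-zero, separable, reflexive Banach space. Let $C([0,\omega_1];X)$ be the Banach space of continuous $X$-valued functions on $[0,\omega_1]$ with the supremum norm, and let $$Y_X=\{F\in C([0,\omega_1];X): F(\omega_1)=0\}.$$ For $\alpha\in[0,\omega_1)$ and $\psi\in X^*$ let $\delta_\alpha\otimes\psi\in (Y_X)^*$ be the functional $F\mapsto\langle F(\alpha),\psi\rangle$. For $g\in C[0,\omega_1]=C([0,\omega_1];\mathbb C)$ and $x\in X$ let $g\otimes x\in C([0,\omega_1];X)$ be the function $\alpha\mapsto g(\alpha)x$, and let $P\in\mathcal B(C[0,\omega_1])$ be given by $Pg=g-g(\omega_1)\mathbf 1$. Then: 1. For every $S\in\mathcal B(Y_X)$ there is a unique $\Theta(S)\in\mathcal B(X)$ for which there exists a club subset $D\subseteq[0,\omega_1)$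 such that $$S^*(\delta_\alpha\otimes\psi)=\delta_\alpha\otimes\Theta(S)^*\psi\qquad\text{for all }\alpha\in D\text{ and all }\psi\in X^*.$$ 2. The map $\Theta:\mathcal B(Y_X)\to\mathcal B(X)$, $S\mapsto\Theta(S)$, is a (unital) algebra homomorphism of norm one, and it is not injective. 3. For every $A\in\mathcal B(X)$ there is a unique operator $P\otimes A\in\mathcal B(C([0,\omega_1];X))$ with $(P\otimes A)(g\otimes x)=(Pg)\otimes(Ax)$ for all $g\in C[0,\omega_1]$ and $x\in X$. It maps $Y_X$ into $Y_X$, and $\Lambda:\mathcal B(X)\to\mathcal B(Y_X)$, $\Lambda(A)=(P\otimes A)|_{Y_X}$, is a (unital) algebra homomorphism of norm one with $\Theta\circ\Lambda=\mathrm{id}_{\mathcal B(X)}$. 4. In particular $\Theta$ is surjective. Hence $Y_X$ does not have the SHAI property, that is, it is not true that for every non-zero Banach space $Z$ every surjective algebra homomorphism $\mathcal B(Y_X)\to\mathcal B(Z)$ is injective. -/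

import Mathlib

open scoped Ordinal

universe u v

noncomputable section

namespace SHAI

/-- The half-open ordinal interval `[0, ω₁)`. -/
abbrev HalfOpen : Type 1 := Set.Iio (ω₁ : Ordinal.{0})

/-- The closed ordinal interval `[0, ω₁]`, a compact Hausdorff space in the order topology. -/
abbrev Closed : Type 1 := Set.Icc (0 : Ordinal.{0}) ω₁

instance : CompactSpace Closed := inferInstance

/-- The point `ω₁` of `[0, ω₁]`. -/
def top : Closed := ⟨ω₁, zero_le, le_rfl⟩

/-- The inclusion `[0, ω₁) ⊆ [0, ω₁]`. -/
def incl (α : HalfOpen) : Closed := ⟨α.1, zero_le, α.2.le⟩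

/-- `B(E)`, the Banach algebra of bounded operators on `E`. -/
abbrev B (E : Type*) [NormedAddCommGroup E] [NormedSpace ℂ E] : Type _ := E →L[ℂ] E

/-- A Banach space is reflexive if the canonical map into its bidual is onto. -/
def IsReflexive (E : Type*) [NormedAddCommGroup E] [NormedSpace ℂ E] : Prop :=
  Function.Surjective (NormedSpace.inclusionInDoubleDual ℂ E)

/-- The Banach space adjoint `T* : F* → E*`, `T* φ = φ ∘ T`, of a bounded operator `T : E → F`. -/
def adj {E F : Type*} [NormedAddCommGroup E] [NormedSpace ℂ E]
    [NormedAddCommGroup F] [NormedSpace ℂ F] (T : E →L[ℂ] F) :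
    StrongDual ℂ F →L[ℂ] StrongDual ℂ E :=
  ContinuousLinearMap.precomp ℂ T

section
variable (X : Type*) [NormedAddCommGroup X] [NormedSpace ℂ X]

/-- `Y_X = {F ∈ C([0, ω₁]; X) : F(ω₁) = 0}` with the supremum norm. -/
def Y : Submodule ℂ C(Closed, X) where
  carrier := {F | F top = 0}
  add_mem' {F G} hF hG := by
    have hF' : F top = 0 := hF
    have hG' : G top = 0 := hG
    simp [hF', hG']
  zero_mem' := by simp
  smul_mem' c F hF := by
    have hF' : F top = 0 := hF
    simp [hF']

variable {X}

/-- The functional `δ_α ⊗ ψ : F ↦ ⟨F(α), ψ⟩` on `Y_X`. -/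
def delta (α : Closed) (ψ : StrongDual ℂ X) : StrongDual ℂ (Y X) :=
  ψ ∘L (ContinuousMap.evalCLM ℂ α) ∘L (Y X).subtypeL

/-- `T ∈ B(X)` satisfies `S*(δ_α ⊗ ψ) = δ_α ⊗ T*ψ` for all `ψ ∈ X*` and all `α` in some
club subset of `[0, ω₁)`. -/
def Represents (S : B (Y X)) (T : B X) : Prop :=
  ∃ D : Set HalfOpen, IsClub D ∧ ∀ α ∈ D, ∀ ψ : StrongDual ℂ X,
    adj S (delta (incl α) ψ) = delta (incl α) (adj T ψ)

/-- The elementary tensor `g ⊗ x : α ↦ g(α) x`, under the canonical identification of the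
injective tensor product of `C[0, ω₁]` and `X` with `C([0, ω₁]; X)`. -/
def tmul (g : C(Closed, ℂ)) (x : X) : C(Closed, X) where
  toFun α := g α • x
  continuous_toFun := by fun_prop

/-- `P g = g - g(ω₁)`, a bounded idempotent operator on `C[0, ω₁]`. -/
def P : B C(Closed, ℂ) :=
  ContinuousLinearMap.id ℂ _ -
    (ContinuousLinearMap.toSpanSingleton ℂ (1 : C(Closed, ℂ))) ∘L ContinuousMap.evalCLM ℂ top

theorem P_apply (g : C(Closed, ℂ)) (α : Closed) : P g α = g α - g top := by
  simp [P]

/-- `R` is the tensor product `U ⊗ A` of the operators `U` and `A`: the bounded operator with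
`R (g ⊗ x) = U g ⊗ A x`. -/
def IsTensor (U : B C(Closed, ℂ)) (A : B X) (R : B C(Closed, X)) : Prop :=
  ∀ (g : C(Closed, ℂ)) (x : X), R (tmul g x) = tmul (U g) (A x)

end

/-- The SHAI property, tested on target spaces in the universe `v`: every surjective algebra
homomorphism `B(E) → B(Z)`, with `Z` a non-zero Banach space, is injective. -/
def HasSHAI (E : Type u) [NormedAddCommGroup E] [NormedSpace ℂ E] : Prop :=
  ∀ (Z : Type v) [NormedAddCommGroup Z] [NormedSpace ℂ Z] [CompleteSpace Z] [Nontrivial Z]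
    (φ : B E →ₙₐ[ℂ] B Z), Function.Surjective φ → Function.Injective φ

end SHAI

end

noncomputable section

namespace SHAI

open Set Topology

/-! Countable data are bounded in `[0, ω₁)`. Extend `S` to an operator `U` on `C([0, ω₁]; X)`
through the projection onto `Y_X`. By a gliding hump and separability of `X`, the value `U F a`
ignores the part of `F` beyond some countable ordinal (`exists_operator_eq_zero`). Conversely, for a
dense sequence of `x`, all `U (1_[0,b] ⊗ x)` vanish beyond a common countable ordinal. On the club
of points closed under both bounds, left continuity makes `U F a` depend on `F a` alone, through an
operator `diag U a` (`exists_closurePoints_eq_diag`). These operators are eventually constant on the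
club, since otherwise some `U (1_[0,d] ⊗ x)` would oscillate to the left of `d`
(`exists_diag_eventually_const`); the constant is `Θ(S)`.

The algebra of `Θ` follows by intersecting two clubs and testing on step functions. On `Y_X`, `P ⊗
A` is composition with `A`, which `Θ` sends back to `A`. -/

theorem incl_lt_incl {a b : HalfOpen} : incl a < incl b ↔ a < b := Iff.rfl

theorem incl_le_incl {a b : HalfOpen} : incl a ≤ incl b ↔ a ≤ b := Iff.rfl

theorem incl_lt_top (a : HalfOpen) : incl a < top := a.2

theorem le_top_closed (a : Closed) : a ≤ top := a.2.2

theorem exists_incl_of_lt_top {a : Closed} (h : a < top) : ∃ b : HalfOpen, incl b = a :=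
  ⟨⟨a.1, h⟩, rfl⟩

/-- A countable family of countable ordinals has a countable strict upper bound. -/
theorem exists_forall_lt {ι : Type*} [Countable ι] (f : ι → HalfOpen) :
    ∃ b : HalfOpen, ∀ i, f i < b := by
  have hs : ∀ i, Order.succ (f i).1 < ω₁ := fun i =>
    (Cardinal.isSuccLimit_omega 1).succ_lt (f i).2
  refine ⟨⟨⨆ i, Order.succ (f i).1, Ordinal.iSup_lt_omega_one hs⟩, fun i => ?_⟩
  have : Order.succ (f i).1 ≤ ⨆ i, Order.succ (f i).1 :=
    le_ciSup (f := fun i => Order.succ (f i).1) Ordinal.bddAbove_of_small i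
  exact Subtype.coe_lt_coe.1 (lt_of_lt_of_le (Order.lt_succ (f i).1) this)

theorem countable_Iic (a : HalfOpen) : (Iic a).Countable := by
  have h : (Iio (Order.succ a.1)).Countable := by
    rw [← Cardinal.le_aleph0_iff_set_countable, Cardinal.mk_Iio_ordinal,
      Cardinal.lift_le_aleph0, ← Cardinal.lt_aleph_one_iff, ← Cardinal.lt_omega_iff_card_lt]
    exact (Cardinal.isSuccLimit_omega 1).succ_lt a.2
  refine (h.preimage (f := Subtype.val) Subtype.val_injective).mono fun b (hb : b ≤ a) => ?_
  exact Order.lt_succ_iff.2 (Subtype.coe_le_coe.2 hb)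

instance : Nonempty HalfOpen := ⟨⟨0, Ordinal.omega_pos 1⟩⟩

/-- This is what makes the intersection of two clubs a club. -/
theorem cof_ne : Order.cof HalfOpen ≠ Cardinal.aleph0 := by
  rw [Ordinal.cof_Iio, Ordinal.lift_omega, Ordinal.lift_one, Cardinal.cof_omega_one]
  exact Cardinal.aleph0_lt_aleph_one.ne'

/-- The non-minimal points below which `h` takes smaller values. -/
def closurePoints (h : HalfOpen → HalfOpen) : Set HalfOpen :=
  {a | (∃ b, b < a) ∧ ∀ b < a, h b < a}

/-- Unboundedness is the usual closing-off: the supremum of the iterates of a function dominating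
`h` on initial segments. -/
theorem isClub_closurePoints (h : HalfOpen → HalfOpen) : IsClub (closurePoints h) := by
  refine ⟨fun t ht hne _ a ha => ?_, fun a => ?_⟩
  · obtain ⟨c, hc⟩ := hne
    refine ⟨?_, fun b hb => ?_⟩
    · obtain ⟨b, hb⟩ := (ht hc).1
      exact ⟨b, hb.trans_le (ha.1 hc)⟩
    · obtain ⟨d, hd, hbd⟩ := (lt_isLUB_iff ha).1 hb
      exact ((ht hd).2 b hbd).trans_le (ha.1 hd)
  · have hk : ∀ c : HalfOpen, ∃ d : HalfOpen, c < d ∧ ∀ b ≤ c, h b < d := by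
      intro c
      have := (countable_Iic c).to_subtype
      obtain ⟨d, hd⟩ := exists_forall_lt (fun b : Iic c => h b)
      obtain ⟨e, he⟩ := exists_forall_lt (fun b : Fin 2 => if b = 0 then c else d)
      exact ⟨e, by simpa using he 0, fun b hb => (hd ⟨b, hb⟩).trans (by simpa using he 1)⟩
    choose k hk1 hk2 using hk
    let g : ℕ → HalfOpen := fun n => k^[n] a
    have hg : ∀ n, g (n + 1) = k (g n) := fun n => Function.iterate_succ_apply' k n a
    obtain ⟨m, hm⟩ := exists_forall_lt g
    -- The supremum of the iterates, taken as their least upper bound by well-foundedness.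
    obtain ⟨s, hs, hmin⟩ := WellFounded.has_min (wellFounded_lt (α := HalfOpen))
      {b | ∀ n, g n ≤ b} ⟨m, fun n => (hm n).le⟩
    refine ⟨s, ⟨⟨a, lt_of_lt_of_le (hk1 a) (hs 1)⟩, fun b hb => ?_⟩, hs 0⟩
    have : ∃ n, b < g n := by
      by_contra! hcon
      exact hmin b hcon hb
    obtain ⟨n, hn⟩ := this
    exact (hk2 (g n) b hn.le).trans_le (hg n ▸ hs (n + 1))

theorem exists_lt_forall_norm_sub_lt {X : Type*} [NormedAddCommGroup X]
    (F : C(Closed, X)) {a : Closed} (ha : ∃ b, b < a) {ε : ℝ}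
    (hε : 0 < ε) : ∃ c < a, ∀ b, c < b → b ≤ a → ‖F b - F a‖ < ε := by
  have h := (Metric.continuous_iff'.1 F.continuous a ε hε)
  obtain ⟨c, hc, hsub⟩ := exists_Ioc_subset_of_mem_nhds h ha
  exact ⟨c, hc, fun b h1 h2 => by simpa [dist_eq_norm] using hsub ⟨h1, h2⟩⟩

/-- A function vanishing at `ω₁` vanishes on a neighbourhood of `ω₁`. -/
theorem exists_forall_eq_zero {X : Type*} [NormedAddCommGroup X]
    (F : C(Closed, X)) (hF : F top = 0) :
    ∃ a : HalfOpen, ∀ b, incl a < b → F b = 0 := by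
  have h : ∀ n : ℕ, ∃ a : HalfOpen, ∀ b, incl a < b → ‖F b‖ < 1 / ((n : ℝ) + 1) := by
    intro n
    obtain ⟨c, hc, hF'⟩ := exists_lt_forall_norm_sub_lt F
      ⟨_, incl_lt_top (Classical.arbitrary HalfOpen)⟩ (Nat.one_div_pos_of_nat (α := ℝ) (n := n))
    obtain ⟨a, rfl⟩ := exists_incl_of_lt_top hc
    exact ⟨a, fun b hb => by simpa [hF] using hF' b hb (le_top_closed b)⟩
  choose a ha using h
  obtain ⟨m, hm⟩ := exists_forall_lt a
  refine ⟨m, fun b hb => ?_⟩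
  by_contra hne
  obtain ⟨n, hn⟩ := exists_nat_one_div_lt (norm_pos_iff.2 hne)
  exact (hn.trans (ha n b ((incl_lt_incl.2 (hm n)).trans hb))).false

/-! ### Truncations, and functionals on functions supported near `ω₁`. -/

section Functions
variable {X : Type u} [NormedAddCommGroup X] [NormedSpace ℂ X]

theorem isOpen_Iic_closed (a : Closed) : IsOpen (Iic a) := by
  have : Iic a = Subtype.val ⁻¹' (Iio (Order.succ a.1)) := by
    ext b
    simp
  rw [this]
  exact isOpen_Iio.preimage continuous_subtype_val

/-- The indicator function of `[0, a]`. -/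
def ind (a : Closed) : C(Closed, ℂ) where
  toFun := (Iic a).indicator 1
  continuous_toFun := IsClopen.continuous_indicator ⟨isClosed_Iic, isOpen_Iic_closed a⟩
    continuous_one

theorem ind_of_le {a b : Closed} (h : b ≤ a) : ind a b = 1 :=
  indicator_of_mem (mem_Iic.2 h) _

theorem ind_of_lt {a b : Closed} (h : a < b) : ind a b = 0 :=
  indicator_of_notMem (fun hb => (not_lt_of_ge (mem_Iic.1 hb)) h) _

/-- The truncation of `F` to `[0, a]`. -/
def cut (a : Closed) (F : C(Closed, X)) : C(Closed, X) where
  toFun b := ind a b • F b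
  continuous_toFun := by fun_prop

theorem cut_apply (a b : Closed) (F : C(Closed, X)) : cut a F b = ind a b • F b := rfl

theorem tmul_apply (g : C(Closed, ℂ)) (x : X) (b : Closed) : tmul g x b = g b • x := rfl

theorem cut_top (F : C(Closed, X)) : cut top F = F := by
  ext b
  simp [cut_apply, ind_of_le (le_top_closed b)]

/-- Truncations are limits of combinations of elementary tensors of indicator functions. -/
theorem cut_mem (W : Submodule ℂ C(Closed, X)) (hW : IsClosed (W : Set C(Closed, X)))
    (a : Closed) (h : ∀ b ≤ a, ∀ x, tmul (ind b) x ∈ W) (F : C(Closed, X)) : cut a F ∈ W := by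
  induction a using WellFoundedLT.induction with
  | ind a ih =>
    rw [← SetLike.mem_coe, ← hW.closure_eq, Metric.mem_closure_iff]
    intro ε hε
    by_cases ha : ∃ b, b < a
    · obtain ⟨c, hc, hF⟩ := exists_lt_forall_norm_sub_lt F ha (half_pos hε)
      -- Keep `F` up to `c` and replace it by the constant `F a` on `(c, a]`, where it varies by
      -- less than `ε / 2`.
      refine ⟨cut c F + (tmul (ind a) (F a) - tmul (ind c) (F a)),
        W.add_mem (ih c hc fun b hb => h b (hb.trans hc.le))
          (W.sub_mem (h a le_rfl _) (h c hc.le _)), ?_⟩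
      refine lt_of_le_of_lt ?_ (half_lt_self hε)
      rw [dist_eq_norm, ContinuousMap.norm_le _ (half_pos hε).le]
      intro b
      simp only [ContinuousMap.sub_apply, ContinuousMap.add_apply, cut_apply, tmul_apply]
      rcases le_or_gt b c with hb | hb
      · simp [ind_of_le hb, ind_of_le (hb.trans hc.le), (half_pos hε).le]
      · rcases le_or_gt b a with hb' | hb'
        · simpa [ind_of_lt hb, ind_of_le hb'] using (hF b hb hb').le
        · simp [ind_of_lt hb, ind_of_lt hb', (half_pos hε).le]
    · push Not at ha
      refine ⟨_, h a le_rfl (F a), ?_⟩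
      have : cut a F = tmul (ind a) (F a) := by
        ext b
        rcases (ha b).eq_or_lt with rfl | hb
        · rfl
        · simp [cut_apply, tmul_apply, ind_of_lt hb]
      simpa [this] using hε

/-- As `F` is small just before `a`, truncating at an earlier `c` suffices, so indicators with `b <
a` are enough. -/
theorem cut_mem_of_apply_eq_zero (W : Submodule ℂ C(Closed, X))
    (hW : IsClosed (W : Set C(Closed, X))) {a : Closed} (ha : ∃ b, b < a)
    (h : ∀ b < a, ∀ x, tmul (ind b) x ∈ W) (F : C(Closed, X)) (hFa : F a = 0) : cut a F ∈ W := by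
  rw [← SetLike.mem_coe, ← hW.closure_eq, Metric.mem_closure_iff]
  intro ε hε
  obtain ⟨c, hc, hF⟩ := exists_lt_forall_norm_sub_lt F ha (half_pos hε)
  refine ⟨cut c F, cut_mem W hW c (fun b hb => h b (hb.trans_lt hc)) F, ?_⟩
  refine lt_of_le_of_lt ?_ (half_lt_self hε)
  rw [dist_eq_norm, ContinuousMap.norm_le _ (half_pos hε).le]
  intro b
  simp only [ContinuousMap.sub_apply, cut_apply]
  rcases le_or_gt b c with hb | hb
  · simp [ind_of_le hb, ind_of_le (hb.trans hc.le), (half_pos hε).le]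
  · rcases le_or_gt b a with hb' | hb'
    · simpa [ind_of_lt hb, ind_of_le hb', hFa] using (hF b hb hb').le
    · simp [ind_of_lt hb, ind_of_lt hb', (half_pos hε).le]

/-- Gliding hump: otherwise `m` functions with disjoint supports sum to a function of norm at most
one on which `μ` has real part at least `m * ε`, for every `m`. -/
theorem exists_forall_re_le (μ : C(Closed, X) →L[ℂ] ℂ) {ε : ℝ} (hε : 0 < ε) :
    ∃ a : HalfOpen, ∀ F : C(Closed, X), ‖F‖ ≤ 1 → F top = 0 → (∀ b ≤ incl a, F b = 0) →
      (μ F).re ≤ ε := by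
  by_contra! hcon
  have key : ∀ (m : ℕ) (a : HalfOpen), ∃ F : C(Closed, X), ‖F‖ ≤ 1 ∧ F top = 0 ∧
      (∀ b ≤ incl a, F b = 0) ∧ m * ε ≤ (μ F).re := by
    intro m
    induction m with
    | zero => exact fun a => ⟨0, by simp⟩
    | succ m ih =>
      intro a
      obtain ⟨F, hF1, hF2, hF3, hF4⟩ := hcon a
      obtain ⟨c, hc⟩ := exists_forall_eq_zero F hF2
      -- Starting `G` beyond `c` keeps its support disjoint from that of `F`.
      obtain ⟨G, hG1, hG2, hG3, hG4⟩ := ih (max a c)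
      refine ⟨F + G, ?_, by simp [hF2, hG2], fun b hb => ?_, ?_⟩
      · rw [ContinuousMap.norm_le _ zero_le_one]
        intro b
        rcases le_or_gt b (incl (max a c)) with hb | hb
        · simpa [hG3 b hb] using (F.norm_coe_le_norm b).trans hF1
        · have : incl c ≤ incl (max a c) := incl_le_incl.2 (le_max_right _ _)
          simpa [hc b (this.trans_lt hb)] using (G.norm_coe_le_norm b).trans hG1
      · have : incl a ≤ incl (max a c) := incl_le_incl.2 (le_max_left _ _)
        simp [hF3 b hb, hG3 b (hb.trans this)]
      · rw [map_add, Complex.add_re]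
        push_cast
        linarith
  obtain ⟨m, hm⟩ := exists_nat_gt (‖μ‖ / ε)
  obtain ⟨F, hF1, -, -, hF4⟩ := key m (Classical.arbitrary _)
  rw [div_lt_iff₀ hε] at hm
  have := (Complex.re_le_norm _).trans (μ.le_opNorm_of_le hF1)
  linarith

/-- A bounded functional vanishes on the functions supported near `ω₁`. -/
theorem exists_functional_eq_zero (μ : C(Closed, X) →L[ℂ] ℂ) :
    ∃ a : HalfOpen, ∀ F : C(Closed, X), F top = 0 → (∀ b ≤ incl a, F b = 0) → μ F = 0 := by
  choose a ha using fun n : ℕ =>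
    exists_forall_re_le μ (Nat.one_div_pos_of_nat (α := ℝ) (n := n))
  obtain ⟨m, hm⟩ := exists_forall_lt a
  have h1 : ∀ F : C(Closed, X), F top = 0 → (∀ b ≤ incl m, F b = 0) → (μ F).re ≤ 0 := by
    intro F hF hFm
    have hpos : 0 < (‖F‖ + 1)⁻¹ := by positivity
    have h2 : (‖F‖ + 1)⁻¹ * (μ F).re ≤ 0 := by
      refine le_of_forall_pos_le_add fun ε hε => ?_
      obtain ⟨n, hn⟩ := exists_nat_one_div_lt hε
      have := ha n ((((‖F‖ + 1)⁻¹ : ℝ) : ℂ) • F) ?_ (by simp [hF]) fun b hb => by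
        simp [hFm b (hb.trans (incl_le_incl.2 (hm n).le))]
      · rw [map_smul, smul_eq_mul, Complex.re_ofReal_mul] at this
        linarith
      · rw [norm_smul, Complex.norm_real, Real.norm_of_nonneg hpos.le, inv_mul_le_iff₀ (by positivity)]
        linarith
    exact nonpos_of_mul_nonpos_right h2 hpos
  refine ⟨m, fun F hF hFm => ?_⟩
  have e1 := h1 F hF hFm
  have e2 := h1 (-F) (by simp [hF]) fun b hb => by simp [hFm b hb]
  have e3 := h1 (Complex.I • F) (by simp [hF]) fun b hb => by simp [hFm b hb]
  have e4 := h1 (-(Complex.I • F)) (by simp [hF]) fun b hb => by simp [hFm b hb]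
  simp at e2 e3 e4
  apply Complex.ext <;> simp <;> linarith

/-- Norming functionals of a dense sequence separate points. -/
theorem exists_separating_seq (X : Type u) [NormedAddCommGroup X] [NormedSpace ℂ X]
    [TopologicalSpace.SeparableSpace X] :
    ∃ φ : ℕ → StrongDual ℂ X, ∀ y, (∀ n, φ n y = 0) → y = 0 := by
  choose φ hφ1 hφ2 using fun n : ℕ => exists_dual_vector'' ℂ (TopologicalSpace.denseSeq X n)
  refine ⟨φ, fun y hy => ?_⟩
  by_contra hne
  obtain ⟨n, hn⟩ := Metric.denseRange_iff.1 (TopologicalSpace.denseRange_denseSeq X) y (‖y‖ / 2)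
    (half_pos (norm_pos_iff.2 hne))
  set x := TopologicalSpace.denseSeq X n
  have h1 : ‖x‖ ≤ ‖y - x‖ := by
    have e : φ n (x - y) = (‖x‖ : ℂ) := by
      rw [map_sub, hy n, sub_zero]
      exact hφ2 n
    have := (φ n).le_of_opNorm_le (hφ1 n) (x - y)
    rw [e, Complex.norm_real, norm_norm, one_mul, norm_sub_rev] at this
    exact this
  rw [dist_eq_norm] at hn
  have := norm_le_norm_add_norm_sub' y x
  linarith

/-- A bounded operator into a separable space vanishes on the functions supported near `ω₁`. -/
theorem exists_operator_eq_zero [TopologicalSpace.SeparableSpace X]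
    (L : C(Closed, X) →L[ℂ] X) :
    ∃ a : HalfOpen, ∀ F : C(Closed, X), F top = 0 → (∀ b ≤ incl a, F b = 0) → L F = 0 := by
  obtain ⟨φ, hφ⟩ := exists_separating_seq X
  choose a ha using fun n => exists_functional_eq_zero (φ n ∘L L)
  obtain ⟨m, hm⟩ := exists_forall_lt a
  exact ⟨m, fun F hF hFm => hφ _ fun n => ha n F hF fun b hb =>
    hFm b (hb.trans (incl_le_incl.2 (hm n).le))⟩

end Functions

/-! ### Diagonal behaviour of operators on a club. -/

section Operators
variable {X : Type u} [NormedAddCommGroup X] [NormedSpace ℂ X]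

/-- `tmul` as a bounded operator in its second variable. -/
def tmulCLM (g : C(Closed, ℂ)) : X →L[ℂ] C(Closed, X) :=
  LinearMap.mkContinuous
    { toFun := tmul g
      map_add' := fun x y => by ext b; simp [tmul_apply]
      map_smul' := fun c x => ContinuousMap.ext fun b => smul_comm (g b) c x } ‖g‖ fun x => by
    rw [ContinuousMap.norm_le _ (by positivity)]
    intro b
    simpa [tmul_apply, norm_smul] using
      mul_le_mul_of_nonneg_right (g.norm_coe_le_norm b) (norm_nonneg x)

@[simp]
theorem tmulCLM_apply (g : C(Closed, ℂ)) (x : X) : tmulCLM g x = tmul g x := rfl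

theorem norm_ind_le (a : Closed) : ‖ind a‖ ≤ 1 := by
  rw [ContinuousMap.norm_le _ zero_le_one]
  intro b
  rcases le_or_gt b a with h | h
  · simp [ind_of_le h]
  · simp [ind_of_lt h]

theorem norm_tmul_ind_le (a : Closed) (x : X) : ‖tmul (ind a) x‖ ≤ ‖x‖ := by
  have h : ‖tmulCLM (ind a) x‖ ≤ ‖ind a‖ * ‖x‖ := by
    exact ContinuousLinearMap.le_of_opNorm_le _
      (LinearMap.mkContinuous_norm_le _ (norm_nonneg _) _) x
  exact h.trans (mul_le_of_le_one_left (norm_nonneg x) (norm_ind_le a))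

theorem cut_eq_tmul_add (a : Closed) (F : C(Closed, X)) :
    cut a F = tmul (ind a) (F a) + cut a (F - tmul (ind a) (F a)) := by
  ext b
  rcases le_or_gt b a with h | h <;> simp [cut_apply, tmul_apply, ind_of_le, ind_of_lt, h]

variable (U : C(Closed, X) →L[ℂ] C(Closed, X))

/-- The operator `x ↦ U (1_[0,a] ⊗ x) (a)`. -/
def diag (a : Closed) : B X := ContinuousMap.evalCLM ℂ a ∘L U ∘L tmulCLM (ind a)

theorem diag_apply (a : Closed) (x : X) : diag U a x = U (tmul (ind a) x) a := rfl

variable [TopologicalSpace.SeparableSpace X]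

open TopologicalSpace in
/-- Off the diagonal an operator into the functions vanishing at `ω₁` is negligible on a club. -/
theorem exists_closurePoints_eq_diag (hU : ∀ F, U F top = 0) :
    ∃ h : HalfOpen → HalfOpen, ∀ k : HalfOpen → HalfOpen, (∀ a, h a ≤ k a) →
      ∀ a ∈ closurePoints k, ∀ F : C(Closed, X), F top = 0 →
        U F (incl a) = diag U (incl a) (F (incl a)) := by
  choose p hp using fun a : HalfOpen =>
    exists_operator_eq_zero (ContinuousMap.evalCLM ℂ (incl a) ∘L U)
  choose q hq using fun (a : HalfOpen) (n : ℕ) =>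
    exists_forall_eq_zero (U (tmul (ind (incl a)) (denseSeq X n))) (hU _)
  choose r hr using fun a => exists_forall_lt (q a)
  -- One bound for three tasks: moving past `a`, ignoring inputs beyond `p a`, and making outputs of
  -- `1_[0,a] ⊗ x` vanish beyond `r a`.
  choose h hh using fun a => exists_forall_lt ![a, p a, r a]
  refine ⟨h, fun k hk a ha F hF => ?_⟩
  have hka : ∀ b < a, h b < a := fun b hb => (hk b).trans_lt (ha.2 b hb)
  have ha' : ∃ b, b < incl a := ha.1.imp' incl fun _ h => h
  -- functions supported beyond `a`
  have h1 : ∀ G : C(Closed, X), G top = 0 → (∀ b ≤ incl a, G b = 0) → U G (incl a) = 0 := by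
    intro G hG hGa
    by_contra hne
    obtain ⟨d, hd, hdG⟩ := exists_lt_forall_norm_sub_lt (U G) ha' (norm_pos_iff.2 hne)
    obtain ⟨d, rfl⟩ := exists_incl_of_lt_top (hd.trans (incl_lt_top a))
    have hb := hka d hd
    -- The point `h d` lies in `(d, a)` and its own bound is below `a`, so `U G` vanishes there.
    have := hdG (incl (h d)) (incl_lt_incl.2 (hh d 0)) (incl_le_incl.2 hb.le)
    have hz : U G (incl (h d)) = 0 := hp (h d) G hG fun b hb' =>
      hGa b (hb'.trans (incl_le_incl.2 ((hh (h d) 1).trans (hka _ hb)).le))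
    simp [hz] at this
  -- functions supported before `a`
  have h2 : ∀ G : C(Closed, X), G (incl a) = 0 → U (cut (incl a) G) (incl a) = 0 := by
    intro G hG
    refine cut_mem_of_apply_eq_zero
      (LinearMap.ker (ContinuousMap.evalCLM ℂ (incl a) ∘L U).toLinearMap)
      (ContinuousLinearMap.isClosed_ker _) ha' (fun b hb x => ?_) G hG
    obtain ⟨b, rfl⟩ := exists_incl_of_lt_top (hb.trans (incl_lt_top a))
    have hz : (ContinuousMap.evalCLM ℂ (incl a) ∘L U ∘L tmulCLM (ind (incl b)) : B X) = 0 := by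
      refine DFunLike.coe_injective ((denseRange_denseSeq X).equalizer
        (ContinuousLinearMap.continuous _) (ContinuousLinearMap.continuous _) (funext fun n => ?_))
      exact hq b n _ (incl_lt_incl.2 ((hr b n).trans ((hh b 2).trans (hka b hb))))
    exact DFunLike.congr_fun hz x
  have h3 : U (cut (incl a) F) (incl a) = diag U (incl a) (F (incl a)) := by
    rw [cut_eq_tmul_add, map_add, ContinuousMap.add_apply, h2 _ (by simp [tmul_apply, ind_of_le]),
      add_zero, diag_apply]
  have h4 := h1 (F - cut (incl a) F) (by simp [cut_apply, hF]) fun b hb => by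
    simp [cut_apply, ind_of_le hb]
  rw [map_sub, ContinuousMap.sub_apply, sub_eq_zero] at h4
  rw [h4, h3]

open TopologicalSpace in
theorem exists_diag_eventually_const (hU : ∀ F, U F top = 0) :
    ∃ (k : HalfOpen → HalfOpen) (T : B X), ∀ a ∈ closurePoints k, ∀ F : C(Closed, X), F top = 0 →
      U F (incl a) = T (F (incl a)) := by
  obtain ⟨h, hh⟩ := exists_closurePoints_eq_diag U hU
  have hdiag : ∀ a ∈ closurePoints h, ∀ b, a ≤ b → ∀ x,
      U (tmul (ind (incl b)) x) (incl a) = diag U (incl a) x := by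
    intro a ha b hb x
    have := hh h (fun _ => le_rfl) a ha (tmul (ind (incl b)) x)
      (by simp [tmul_apply, ind_of_lt (incl_lt_top b)])
    rw [this, tmul_apply, ind_of_le (incl_le_incl.2 hb), one_smul]
  have hosc : ∀ (x : X) (ε : ℝ), 0 < ε → ∃ b : HalfOpen, ∀ a ∈ closurePoints h,
      ∀ a' ∈ closurePoints h, b < a → b < a' → dist (diag U (incl a) x) (diag U (incl a') x) < ε := by
    intro x ε hε
    by_contra! hcon
    choose f hf g hg hbf hbg hfg using hcon
    -- At a closure point `d` of `k`, bad pairs occur arbitrarily close below `d`; there the single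
    -- function `U (1_[0,d] ⊗ x)` takes both diagonal values, against its left continuity at `d`.
    let k : HalfOpen → HalfOpen := fun a => max (f a) (g a)
    obtain ⟨d, hd⟩ := (isClub_closurePoints k).nonempty
    obtain ⟨c, hc, hcd⟩ := exists_lt_forall_norm_sub_lt (U (tmul (ind (incl d)) x))
      (a := incl d) (hd.1.imp' incl fun _ h => h) (half_pos hε)
    obtain ⟨c, rfl⟩ := exists_incl_of_lt_top (hc.trans (incl_lt_top d))
    have hkc := hd.2 c hc
    have hfc : f c < d := lt_of_le_of_lt (by simp [k]) hkc
    have hgc : g c < d := lt_of_le_of_lt (by simp [k]) hkc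
    have e1 := hcd (incl (f c)) (incl_lt_incl.2 (hbf c)) (incl_le_incl.2 hfc.le)
    have e2 := hcd (incl (g c)) (incl_lt_incl.2 (hbg c)) (incl_le_incl.2 hgc.le)
    rw [hdiag _ (hf c) _ hfc.le, ← dist_eq_norm] at e1
    rw [hdiag _ (hg c) _ hgc.le, ← dist_eq_norm] at e2
    have := dist_triangle_right (diag U (incl (f c)) x) (diag U (incl (g c)) x)
      (U (tmul (ind (incl d)) x) (incl d))
    linarith [hfg c]
  choose b hb using fun (n m : ℕ) =>
    hosc (denseSeq X n) (1 / ((m : ℝ) + 1)) Nat.one_div_pos_of_nat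
  obtain ⟨s, hs⟩ := exists_forall_lt (fun p : ℕ × ℕ => b p.1 p.2)
  have hconst : ∀ a ∈ closurePoints h, ∀ a' ∈ closurePoints h, s < a → s < a' →
      diag U (incl a) = diag U (incl a') := by
    intro a ha a' ha' hsa hsa'
    refine DFunLike.coe_injective ((denseRange_denseSeq X).equalizer
      (ContinuousLinearMap.continuous _) (ContinuousLinearMap.continuous _) (funext fun n => ?_))
    by_contra hne
    obtain ⟨m, hm⟩ := exists_nat_one_div_lt (dist_pos.2 hne)
    exact (hm.trans (hb n m a ha a' ha' ((hs (n, m)).trans hsa) ((hs (n, m)).trans hsa'))).false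
  -- Non-minimality of closure points is what forces `s < a`.
  have hsub : ∀ a ∈ closurePoints (fun a => max (h a) s), a ∈ closurePoints h ∧ s < a := by
    rintro a ⟨⟨e, he⟩, ha⟩
    exact ⟨⟨⟨e, he⟩, fun b hb => (le_max_left _ _).trans_lt (ha b hb)⟩,
      (le_max_right _ _).trans_lt (ha e he)⟩
  obtain ⟨a₁, ha₁⟩ := (isClub_closurePoints (fun a => max (h a) s)).nonempty
  refine ⟨fun a => max (h a) s, diag U (incl a₁), fun a ha F hF => ?_⟩
  have := hh _ (fun _ => le_max_left _ _) a ha F hF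
  rw [this, hconst a (hsub a ha).1 a₁ (hsub a₁ ha₁).1 (hsub a ha).2 (hsub a₁ ha₁).2]

end Operators

/-! ### The homomorphism `Θ`. -/

section Representation
variable {X : Type u} [NormedAddCommGroup X] [NormedSpace ℂ X]

/-- The projection `F ↦ F - F(ω₁)` of `C([0, ω₁]; X)` onto `Y_X`. -/
def proj : C(Closed, X) →L[ℂ] Y X :=
  (ContinuousLinearMap.id ℂ C(Closed, X) - tmulCLM 1 ∘L ContinuousMap.evalCLM ℂ top).codRestrict (Y X)
    fun F => show (F - tmul 1 (F top) : C(Closed, X)) top = 0 by simp [tmul_apply]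

theorem proj_apply (F : C(Closed, X)) (b : Closed) :
    (proj F : C(Closed, X)) b = F b - F top := by
  change (F - tmul 1 (F top) : C(Closed, X)) b = _
  simp [tmul_apply]

theorem coe_apply_top (F : Y X) : (F : C(Closed, X)) top = 0 := F.2

theorem proj_coe (F : Y X) : proj (F : C(Closed, X)) = F := by
  ext b
  simp [proj_apply, coe_apply_top]

/-- `1_[0,a] ⊗ x` as an element of `Y_X`, for `a < ω₁`. -/
def step (a : HalfOpen) (x : X) : Y X :=
  ⟨tmul (ind (incl a)) x, show tmul (ind (incl a)) x top = 0 by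
    simp [tmul_apply, ind_of_lt (incl_lt_top a)]⟩

theorem step_apply_self (a : HalfOpen) (x : X) : (step a x : C(Closed, X)) (incl a) = x := by
  simp [step, tmul_apply, ind_of_le]

theorem norm_step_le (a : HalfOpen) (x : X) : ‖step a x‖ ≤ ‖x‖ := norm_tmul_ind_le _ x

theorem represents_iff {S : B (Y X)} {T : B X} :
    Represents S T ↔ ∃ D : Set HalfOpen, IsClub D ∧ ∀ a ∈ D, ∀ F : Y X,
      (S F : C(Closed, X)) (incl a) = T ((F : C(Closed, X)) (incl a)) := by
  refine exists_congr fun D => and_congr_right fun _ => forall₂_congr fun a _ =>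
    ⟨fun h F => ?_, fun h ψ => ContinuousLinearMap.ext fun F => congrArg ψ (h F)⟩
  exact (SeparatingDual.eq_iff_forall_dual_eq (R := ℂ)).2 fun ψ => DFunLike.congr_fun (h ψ) F

theorem exists_represents [TopologicalSpace.SeparableSpace X] (S : B (Y X)) :
    ∃ T, Represents S T := by
  obtain ⟨k, T, h⟩ := exists_diag_eventually_const ((Y X).subtypeL ∘L S ∘L proj)
    fun F => coe_apply_top (S (proj F))
  refine ⟨T, represents_iff.2 ⟨_, isClub_closurePoints k, fun a ha F => ?_⟩⟩
  rw [← h a ha F (coe_apply_top F)]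
  simp [proj_coe]

/-- Two representation conditions hold simultaneously on a club. -/
theorem Represents.exists_common {S₁ S₂ : B (Y X)} {T₁ T₂ : B X} (h₁ : Represents S₁ T₁)
    (h₂ : Represents S₂ T₂) : ∃ D : Set HalfOpen, IsClub D ∧ ∀ a ∈ D, ∀ F : Y X,
      (S₁ F : C(Closed, X)) (incl a) = T₁ ((F : C(Closed, X)) (incl a)) ∧
      (S₂ F : C(Closed, X)) (incl a) = T₂ ((F : C(Closed, X)) (incl a)) := by
  obtain ⟨D₁, hD₁, h₁⟩ := represents_iff.1 h₁
  obtain ⟨D₂, hD₂, h₂⟩ := represents_iff.1 h₂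
  exact ⟨D₁ ∩ D₂, hD₁.inter cof_ne hD₂, fun a ha F => ⟨h₁ a ha.1 F, h₂ a ha.2 F⟩⟩

theorem Represents.unique {S : B (Y X)} {T₁ T₂ : B X} (h₁ : Represents S T₁)
    (h₂ : Represents S T₂) : T₁ = T₂ := by
  obtain ⟨D, hD, h⟩ := h₁.exists_common h₂
  obtain ⟨a, ha⟩ := hD.nonempty
  ext x
  simpa [step_apply_self] using (h a ha (step a x)).1.symm.trans (h a ha (step a x)).2

theorem Represents.norm_le {S : B (Y X)} {T : B X} (h : Represents S T) : ‖T‖ ≤ ‖S‖ := by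
  obtain ⟨D, hD, h⟩ := represents_iff.1 h
  obtain ⟨a, ha⟩ := hD.nonempty
  refine T.opNorm_le_bound (norm_nonneg _) fun x => ?_
  have := h a ha (step a x)
  rw [step_apply_self] at this
  rw [← this]
  calc ‖(S (step a x) : C(Closed, X)) (incl a)‖ ≤ ‖S (step a x)‖ :=
        (S (step a x) : C(Closed, X)).norm_coe_le_norm _
    _ ≤ ‖S‖ * ‖x‖ := S.le_opNorm_of_le (norm_step_le a x)

theorem Represents.add {S₁ S₂ : B (Y X)} {T₁ T₂ : B X} (h₁ : Represents S₁ T₁)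
    (h₂ : Represents S₂ T₂) : Represents (S₁ + S₂) (T₁ + T₂) := by
  obtain ⟨D, hD, h⟩ := h₁.exists_common h₂
  exact represents_iff.2 ⟨D, hD, fun a ha F => by simp [(h a ha F).1, (h a ha F).2]⟩

theorem Represents.mul {S₁ S₂ : B (Y X)} {T₁ T₂ : B X} (h₁ : Represents S₁ T₁)
    (h₂ : Represents S₂ T₂) : Represents (S₁ * S₂) (T₁ * T₂) := by
  obtain ⟨D, hD, h⟩ := h₁.exists_common h₂
  exact represents_iff.2 ⟨D, hD, fun a ha F => by simp [(h a ha (S₂ F)).1, (h a ha F).2]⟩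

theorem Represents.smul (c : ℂ) {S : B (Y X)} {T : B X} (h : Represents S T) :
    Represents (c • S) (c • T) := by
  obtain ⟨D, hD, h⟩ := represents_iff.1 h
  exact represents_iff.2 ⟨D, hD, fun a ha F => by simp [h a ha F]⟩

theorem represents_one : Represents (1 : B (Y X)) (1 : B X) :=
  represents_iff.2 ⟨univ, .univ, fun _ _ _ => rfl⟩

variable (X) in
/-- The homomorphism `S ↦ Θ(S)`. -/
def theta [TopologicalSpace.SeparableSpace X] : B (Y X) →A[ℂ] B X :=
  let Θ : B (Y X) → B X := fun S => (exists_represents S).choose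
  have hΘ : ∀ S, Represents S (Θ S) := fun S => (exists_represents S).choose_spec
  let l : B (Y X) →ₗ[ℂ] B X :=
    { toFun := Θ
      map_add' := fun S₁ S₂ => (hΘ (S₁ + S₂)).unique ((hΘ S₁).add (hΘ S₂))
      map_smul' := fun c S => (hΘ (c • S)).unique ((hΘ S).smul c) }
  { AlgHom.ofLinearMap l ((hΘ 1).unique represents_one)
      fun S₁ S₂ => (hΘ (S₁ * S₂)).unique ((hΘ S₁).mul (hΘ S₂)) with
    cont := (l.mkContinuous 1 fun S => (hΘ S).norm_le.trans (one_mul ‖S‖).ge).cont }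

theorem represents_theta [TopologicalSpace.SeparableSpace X] (S : B (Y X)) :
    Represents S (theta X S) := (exists_represents S).choose_spec

/-- A unital contractive homomorphism has norm one. -/
theorem norm_eq_one_of_le {E F : Type*} [NormedRing E] [NormedRing F] [NormedAlgebra ℂ E]
    [NormedAlgebra ℂ F] [NormOneClass E] [NormOneClass F] (φ : E →A[ℂ] F)
    (h : ∀ x, ‖φ x‖ ≤ ‖x‖) : ‖φ.toContinuousLinearMap‖ = 1 := by
  refine le_antisymm (φ.toContinuousLinearMap.opNorm_le_bound zero_le_one fun x => ?_) ?_
  · simpa using h x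
  · simpa using φ.toContinuousLinearMap.le_opNorm 1

instance [Nontrivial X] : Nontrivial (Y X) := by
  obtain ⟨x, hx⟩ := exists_ne (0 : X)
  refine ⟨step (Classical.arbitrary _) x, 0, fun h => hx ?_⟩
  rw [← step_apply_self (Classical.arbitrary _) x, h]
  rfl

theorem not_injective_theta [Nontrivial X] [TopologicalSpace.SeparableSpace X] :
    ¬ Function.Injective (theta X) := by
  intro hinj
  obtain ⟨x, hx⟩ := exists_ne (0 : X)
  let o : HalfOpen := ⟨0, Ordinal.omega_pos 1⟩
  have ho : ∀ a : HalfOpen, o ≤ a := fun a => Subtype.coe_le_coe.1 (zero_le (a := a.1))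
  -- `F ↦ 1_{0} ⊗ F(0)` is non-zero but lives at the point `0`, which a club can avoid.
  let S : B (Y X) :=
    proj ∘L tmulCLM (ind (incl o)) ∘L ContinuousMap.evalCLM ℂ (incl o) ∘L (Y X).subtypeL
  have hSapp : ∀ (F : Y X) (b : Closed), (S F : C(Closed, X)) b =
      ind (incl o) b • (F : C(Closed, X)) (incl o) := by
    intro F b
    change (proj (tmul (ind (incl o)) ((F : C(Closed, X)) (incl o))) : C(Closed, X)) b = _
    simp [proj_apply, tmul_apply, ind_of_lt (incl_lt_top o)]
  have hS : Represents S 0 := by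
    refine represents_iff.2 ⟨_, isClub_closurePoints id, fun a ha F => ?_⟩
    obtain ⟨b, hb⟩ := ha.1
    rw [hSapp, ind_of_lt (incl_lt_incl.2 ((ho b).trans_lt hb))]
    simp
  have hS0 : S = 0 := hinj (((represents_theta S).unique hS).trans (map_zero (theta X)).symm)
  have := hSapp (step o x) (incl o)
  rw [hS0, step_apply_self, ind_of_le le_rfl, one_smul] at this
  exact hx this.symm

end Representation

/-! ### The operators `P ⊗ A` and the right inverse `Λ`. -/

section Tensor
variable {X : Type u} [NormedAddCommGroup X] [NormedSpace ℂ X]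

/-- Operators agreeing on elementary tensors are equal. -/
theorem ext_tmul {R₁ R₂ : B C(Closed, X)} (h : ∀ g x, R₁ (tmul g x) = R₂ (tmul g x)) : R₁ = R₂ := by
  ext1 F
  have := cut_mem (LinearMap.ker (R₁ - R₂).toLinearMap) (ContinuousLinearMap.isClosed_ker _) top
    (fun b _ x => by simp [h]) F
  rw [cut_top] at this
  simpa [sub_eq_zero] using this

/-- The operator `F ↦ A ∘ F` on `Y_X`. -/
def compLeft (A : B X) : B (Y X) :=
  (A.compLeftContinuous ℂ Closed ∘L (Y X).subtypeL).codRestrict (Y X) fun F =>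
    show A ((F : C(Closed, X)) top) = 0 by rw [coe_apply_top, map_zero]

theorem compLeft_apply (A : B X) (F : Y X) (b : Closed) :
    (compLeft A F : C(Closed, X)) b = A ((F : C(Closed, X)) b) := rfl

theorem norm_compLeft_le (A : B X) : ‖compLeft A‖ ≤ ‖A‖ := by
  refine ContinuousLinearMap.opNorm_le_bound _ (norm_nonneg _) fun F => ?_
  change ‖(compLeft A F : C(Closed, X))‖ ≤ _
  rw [ContinuousMap.norm_le _ (by positivity)]
  intro b
  rw [compLeft_apply]
  exact A.le_opNorm_of_le ((F : C(Closed, X)).norm_coe_le_norm b)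

variable (X) in
/-- The homomorphism `A ↦ (P ⊗ A)|_{Y_X}`. -/
def lambda : B X →A[ℂ] B (Y X) :=
  let l : B X →ₗ[ℂ] B (Y X) :=
    { toFun := compLeft
      map_add' := fun _ _ => rfl
      map_smul' := fun _ _ => rfl }
  { AlgHom.ofLinearMap l rfl fun _ _ => rfl with
    cont := (l.mkContinuous 1 fun A => (norm_compLeft_le A).trans (one_mul ‖A‖).ge).cont }

theorem lambda_apply (A : B X) : lambda X A = compLeft A := rfl

theorem isTensor_compLeft (A : B X) : IsTensor P A ((Y X).subtypeL ∘L compLeft A ∘L proj) := by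
  intro g x
  ext b
  change (compLeft A (proj (tmul g x)) : C(Closed, X)) b = _
  simp [compLeft_apply, proj_apply, tmul_apply, P_apply, sub_smul]

theorem existsUnique_isTensor (A : B X) : ∃! R : B C(Closed, X), IsTensor P A R :=
  ⟨_, isTensor_compLeft A, fun _ hR => ext_tmul fun g x =>
    (hR g x).trans (isTensor_compLeft A g x).symm⟩

theorem lambda_eq_of_isTensor (A : B X) (R : B C(Closed, X)) (hR : IsTensor P A R) (F : Y X) :
    (lambda X A F : C(Closed, X)) = R F := by
  rw [(existsUnique_isTensor A).unique hR (isTensor_compLeft A)]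
  simp [proj_coe, lambda_apply]

theorem theta_lambda [TopologicalSpace.SeparableSpace X] (A : B X) : theta X (lambda X A) = A :=
  (represents_theta _).unique (represents_iff.2 ⟨univ, .univ, fun _ _ _ => rfl⟩)

end Tensor

end SHAI

end

theorem theorem1p7 (X : Type u) [NormedAddCommGroup X] [NormedSpace ℂ X] [CompleteSpace X]
    [Nontrivial X] [TopologicalSpace.SeparableSpace X] (hX : SHAI.IsReflexive X) :
    -- existence and uniqueness of `Θ(S)`
    (∀ S : SHAI.B (SHAI.Y X), ∃! T : SHAI.B X, SHAI.Represents S T) ∧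
    -- `Θ` is a non-injective algebra homomorphism of norm one
    ∃ Θ : SHAI.B (SHAI.Y X) →A[ℂ] SHAI.B X,
      (∀ S, SHAI.Represents S (Θ S)) ∧
      ‖Θ.toContinuousLinearMap‖ = 1 ∧
      ¬ Function.Injective Θ ∧
      -- `P ⊗ A` is well defined, and `Λ(A) = (P ⊗ A)|_{Y_X}` is a homomorphic right inverse
      (∀ A : SHAI.B X, ∃! R : SHAI.B C(SHAI.Closed, X), SHAI.IsTensor SHAI.P A R) ∧
      (∃ Λ : SHAI.B X →A[ℂ] SHAI.B (SHAI.Y X),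
        (∀ (A : SHAI.B X) (R : SHAI.B C(SHAI.Closed, X)), SHAI.IsTensor SHAI.P A R →
          ∀ F : SHAI.Y X, (Λ A F : C(SHAI.Closed, X)) = R F) ∧
        ‖Λ.toContinuousLinearMap‖ = 1 ∧
        ∀ A, Θ (Λ A) = A) ∧
      Function.Surjective Θ ∧
      ¬ SHAI.HasSHAI.{max 1 u, u} (SHAI.Y X) := by
  have hsurj : Function.Surjective (SHAI.theta X) := fun A => ⟨_, SHAI.theta_lambda A⟩
  refine ⟨fun S => ⟨_, SHAI.represents_theta S, fun T hT => hT.unique (SHAI.represents_theta S)⟩,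
    SHAI.theta X, SHAI.represents_theta,
    SHAI.norm_eq_one_of_le _ fun S => (SHAI.represents_theta S).norm_le,
    SHAI.not_injective_theta, SHAI.existsUnique_isTensor,
    ⟨SHAI.lambda X, SHAI.lambda_eq_of_isTensor,
      SHAI.norm_eq_one_of_le _ SHAI.norm_compLeft_le, SHAI.theta_lambda⟩, hsurj, fun h => ?_⟩
  -- `Θ` itself, with target space `X`, refutes SHAI.
  exact SHAI.not_injective_theta (h X ((SHAI.theta X).toAlgHom : _ →ₙₐ[ℂ] _) hsurj)
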